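/- Let $\mathfrak g$ be a six-dimensional real Lie algebra which is indecomposable, i.e. not the direct sum of two non-zero ideals, and assume that its nilradical (its largest nilpotent ideal) is isomorphic, as a Lie algebra, to the Abelian Lie algebra $\mathbb R^5$. Then $\mathfrak g$ does not admit a half-flat $\mathrm{SU}(3)$-structure. Here a half-flat $\mathrm{SU}(3)$-structure on $\mathfrak g$ is a pair of stable forms $(\omega,\rho)\in\Lambda^2\mathfrak g^*\times\Lambda^3\mathfrak g^*$ (a form is stable if its orbit under $\mathrm{GL}(\mathfrak g)$ is open) such that, for some orientation of $\mathfrak g$, $$\lambda(\rho)<0,\qquad \omega\wedge\rho=0,\qquad d\rho=0,\qquad d(\omega\wedge\omega)=0,$$ and $g(x,y):=\omega(J_\rho x,y)$ is symmetric and positive definite. Here $d$ is the Chevalley–Eilenberg differential. With $\kappa:\Lambda^5\mathfrak g^*\to\mathfrak g\otimes\Lambda^6\mathfrak g^*$ the natural isomorphism, inverse to contraction of the vector with the six-form, $$K_\rho(v)=\kappa\big((v\lrcorner\rho)\wedge\rho\big)\in\mathfrak g\otimes\Lambda^6\mathfrak g^*,\qquad \lambda(\rho)=\tfrac16\operatorname{tr}K_\rho^2\in(\Lambda^6\mathfrak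 g^*)^{\otimes2},\qquad J_\rho=\frac{1}{\sqrt{|\lambda(\rho)|}}K_\rho,$$ where $\sqrt{|\lambda(\rho)|}\in\Lambda^6\mathfrak g^*$ is the positively oriented root. -/

import Mathlib

namespace HalfFlat

open scoped Topology

section Forms

variable {V : Type*} [AddCommGroup V] [Module ℝ V]

/-- The exterior (wedge) product `a ∧ b` of a `p`-form and a `q`-form, normalised by
`(a ∧ b)(v) = ∑ sign(σ) a(v ∘ σ ∘ inl) b(v ∘ σ ∘ inr)`, the sum running over `(p,q)`-shuffles. -/
noncomputable def wedge {p q : ℕ} (a : V [⋀^Fin p]→ₗ[ℝ] ℝ) (b : V [⋀^Fin q]→ₗ[ℝ] ℝ) :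
    V [⋀^Fin (p + q)]→ₗ[ℝ] ℝ :=
  ((LinearMap.mul' ℝ ℝ).compAlternatingMap (a.domCoprod b)).domDomCongr finSumFinEquiv

theorem wedge_add_left {p q : ℕ} (a a' : V [⋀^Fin p]→ₗ[ℝ] ℝ) (b : V [⋀^Fin q]→ₗ[ℝ] ℝ) :
    wedge (a + a') b = wedge a b + wedge a' b := by
  unfold wedge
  rw [← AlternatingMap.domCoprod'_apply, TensorProduct.add_tmul, map_add,
    AlternatingMap.domCoprod'_apply, AlternatingMap.domCoprod'_apply]
  ext x
  simp only [LinearMap.compAlternatingMap_apply, AlternatingMap.domDomCongr_apply,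
    AlternatingMap.add_apply, map_add]

theorem wedge_smul_left {p q : ℕ} (c : ℝ) (a : V [⋀^Fin p]→ₗ[ℝ] ℝ) (b : V [⋀^Fin q]→ₗ[ℝ] ℝ) :
    wedge (c • a) b = c • wedge a b := by
  unfold wedge
  rw [← AlternatingMap.domCoprod'_apply, ← TensorProduct.smul_tmul', map_smul,
    AlternatingMap.domCoprod'_apply]
  ext x
  simp only [LinearMap.compAlternatingMap_apply, AlternatingMap.domDomCongr_apply,
    AlternatingMap.smul_apply, map_smul]

/-- A form `α ∈ Λ^k V^*` is stable if its orbit under the natural action of `GL(V)` is open.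
The vector space `Λ^k V^*` carries the module topology; for finite-dimensional `V` this is its
usual (unique Hausdorff) vector space topology. -/
def IsStable {k : ℕ} (α : V [⋀^Fin k]→ₗ[ℝ] ℝ) : Prop :=
  IsOpen[moduleTopology ℝ (V [⋀^Fin k]→ₗ[ℝ] ℝ)]
    {β | ∃ e : V ≃ₗ[ℝ] V, β = α.compLinearMap e.toLinearMap}

/-- For a volume form `ν` on a six-dimensional space, `w ↦ w ⌟ ν` is bijective onto `Λ⁵ V^*`. -/
theorem contraction_bijective (hV : Module.finrank ℝ V = 6)
    {ν : V [⋀^Fin 6]→ₗ[ℝ] ℝ} (hν : ν ≠ 0) :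
    Function.Bijective (AlternatingMap.curryLeft (n := 5) ν) := by
  have : FiniteDimensional ℝ V := Module.finite_of_finrank_eq_succ hV
  have hinj : Function.Injective (AlternatingMap.curryLeft (n := 5) ν) := by
    rw [← LinearMap.ker_eq_bot, LinearMap.ker_eq_bot']
    intro w hw
    by_contra hw0
    apply hν
    have hli : LinearIndepOn ℝ id ({w} : Set V) := by
      exact LinearIndepOn.singleton hw0
    let B := Module.Basis.extend hli
    have hwB : w ∈ hli.extend (Set.subset_univ _) :=
      hli.subset_extend (Set.subset_univ _) (Set.mem_singleton w)
    let _ : Fintype (hli.extend (Set.subset_univ ({w} : Set V))) :=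
      FiniteDimensional.fintypeBasisIndex B
    have hcard : Fintype.card (hli.extend (Set.subset_univ ({w} : Set V))) = 6 := by
      rw [← Module.finrank_eq_card_basis B, hV]
    let e0 := Fintype.equivFinOfCardEq hcard
    let e := e0.trans (Equiv.swap (e0 ⟨w, hwB⟩) 0)
    let C := B.reindex e
    have hC : C 0 = w := by
      have h0 : e.symm 0 = ⟨w, hwB⟩ := by
        rw [Equiv.symm_apply_eq]; simp [e]
      simp only [C, Module.Basis.reindex_apply, h0, B, Module.Basis.extend_apply_self]
    have hz : ν C = 0 := by
      have h1 := DFunLike.congr_fun hw (Fin.tail C)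
      rw [AlternatingMap.curryLeft_apply_apply] at h1
      have h2 : (Matrix.vecCons w (Fin.tail C) : Fin 6 → V) = C := by
        rw [← hC]; exact Fin.cons_self_tail (C : Fin 6 → V)
      rw [h2] at h1
      simpa using h1
    exact (AlternatingMap.map_basis_eq_zero_iff C ν).mp hz
  have hfin : Module.finrank ℝ V = Module.finrank ℝ (V [⋀^Fin 5]→ₗ[ℝ] ℝ) := by
    rw [LinearEquiv.finrank_eq
      (exteriorPower.alternatingMapLinearEquiv (R := ℝ) (M := V) (N := ℝ) (n := 5)),
      Module.finrank_linearMap_self, exteriorPower.finrank_eq, hV]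
    rfl
  have : FiniteDimensional ℝ (V [⋀^Fin 5]→ₗ[ℝ] ℝ) :=
    Module.finite_of_finrank_pos (by omega)
  exact ⟨hinj, (LinearMap.injective_iff_surjective_of_finrank_eq_finrank hfin).mp hinj⟩

/-- The natural isomorphism `κ : Λ⁵ V^* ≅ V ⊗ Λ⁶ V^*`, `w ⌟ ν ↦ w ⊗ ν`, where `Λ⁶ V^*` is
identified with `ℝ` by the volume form `ν`. -/
noncomputable def kappa (hV : Module.finrank ℝ V = 6)
    {ν : V [⋀^Fin 6]→ₗ[ℝ] ℝ} (hν : ν ≠ 0) : (V [⋀^Fin 5]→ₗ[ℝ] ℝ) ≃ₗ[ℝ] V :=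
  (LinearEquiv.ofBijective _ (contraction_bijective hV hν)).symm

/-- The linear map `v ↦ (v ⌟ ρ) ∧ ρ` from `V` to `Λ⁵ V^*`. -/
noncomputable def contractWedge (ρ : V [⋀^Fin 3]→ₗ[ℝ] ℝ) : V →ₗ[ℝ] V [⋀^Fin 5]→ₗ[ℝ] ℝ where
  toFun v := wedge (AlternatingMap.curryLeft (n := 2) ρ v) ρ
  map_add' u v := by
    simp only [wedge_add_left, map_add]
  map_smul' c v := by
    simp only [wedge_smul_left, map_smul, RingHom.id_apply]

/-- Hitchin's endomorphism: `K_ρ(v) = κ((v ⌟ ρ) ∧ ρ)`, with `Λ⁶ V^*` trivialised by `ν`. -/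
noncomputable def hitchinK (hV : Module.finrank ℝ V = 6)
    {ν : V [⋀^Fin 6]→ₗ[ℝ] ℝ} (hν : ν ≠ 0) (ρ : V [⋀^Fin 3]→ₗ[ℝ] ℝ) : V →ₗ[ℝ] V :=
  (kappa hV hν).toLinearMap ∘ₗ contractWedge ρ

/-- The characterisation of `K_ρ`: `K_ρ(v) ⌟ ν = (v ⌟ ρ) ∧ ρ`. -/
theorem contraction_hitchinK (hV : Module.finrank ℝ V = 6)
    {ν : V [⋀^Fin 6]→ₗ[ℝ] ℝ} (hν : ν ≠ 0) (ρ : V [⋀^Fin 3]→ₗ[ℝ] ℝ) (v : V) :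
    AlternatingMap.curryLeft (n := 5) ν (hitchinK hV hν ρ v) =
      wedge (p := 2) (q := 3) (AlternatingMap.curryLeft (n := 2) ρ v) ρ := by
  have h1 : ∀ β, AlternatingMap.curryLeft (n := 5) ν (kappa hV hν β) = β := fun β =>
    LinearEquiv.apply_symm_apply (LinearEquiv.ofBijective _ (contraction_bijective hV hν)) β
  have h2 : hitchinK hV hν ρ v = kappa hV hν (contractWedge ρ v) := rfl
  rw [h2, h1]
  simp only [contractWedge, LinearMap.coe_mk, AddHom.coe_mk]

/-- Hitchin's quartic invariant `λ(ρ) = (1/6) tr K_ρ²`, as a multiple of `ν ⊗ ν`. Its sign does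
not depend on `ν`. -/
noncomputable def hitchinLambda (hV : Module.finrank ℝ V = 6)
    {ν : V [⋀^Fin 6]→ₗ[ℝ] ℝ} (hν : ν ≠ 0) (ρ : V [⋀^Fin 3]→ₗ[ℝ] ℝ) : ℝ :=
  (1 / 6) * LinearMap.trace ℝ V (hitchinK hV hν ρ ∘ₗ hitchinK hV hν ρ)

/-- The endomorphism `J_ρ = |λ(ρ)|^{-1/2} K_ρ`. It depends on `ν` only through the orientation
for which `ν` is positive. -/
noncomputable def hitchinJ (hV : Module.finrank ℝ V = 6)
    {ν : V [⋀^Fin 6]→ₗ[ℝ] ℝ} (hν : ν ≠ 0) (ρ : V [⋀^Fin 3]→ₗ[ℝ] ℝ) : V →ₗ[ℝ] V :=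
  (1 / Real.sqrt |hitchinLambda hV hν ρ|) • hitchinK hV hν ρ

end Forms

section LieAlgebras

/-- The Lie algebra `ℝⁿ`: the vector space of real `n`-tuples with the zero bracket. -/
def AbelianLie (n : ℕ) : Type := Fin n → ℝ

noncomputable instance (n : ℕ) : AddCommGroup (AbelianLie n) :=
  inferInstanceAs (AddCommGroup (Fin n → ℝ))

noncomputable instance (n : ℕ) : Module ℝ (AbelianLie n) :=
  inferInstanceAs (Module ℝ (Fin n → ℝ))

noncomputable instance (n : ℕ) : LieRing (AbelianLie n) where
  bracket _ _ := 0
  add_lie _ _ _ := (add_zero 0).symm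
  lie_add _ _ _ := (add_zero 0).symm
  lie_self _ := rfl
  leibniz_lie _ _ _ := (add_zero 0).symm

noncomputable instance (n : ℕ) : LieAlgebra ℝ (AbelianLie n) where
  lie_smul c _ _ := (smul_zero c).symm

variable (g : Type*) [LieRing g] [LieAlgebra ℝ g]

/-- The nilradical: the sum of all ideals of `g` that are nilpotent as Lie algebras. For
finite-dimensional `g` it is the largest nilpotent ideal. -/
def nilradical : LieIdeal ℝ g := sSup {I : LieIdeal ℝ g | LieRing.IsNilpotent I}

/-- `g` is indecomposable: it is not a direct sum of two non-zero ideals. -/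
def IsIndecomposable : Prop :=
  ∀ I J : LieIdeal ℝ g, IsCompl I J → I = ⊥ ∨ J = ⊥

variable {g}

/-- The Chevalley-Eilenberg differential of a `(k+1)`-form `α` on a Lie algebra:
`dα(x₀,…,x_{k+1}) = ∑_{i<j} (-1)^{i+j} α([x_i,x_j], x₀,…,x̂_i,…,x̂_j,…,x_{k+1})`. -/
noncomputable def ceDiff {k : ℕ} (α : g [⋀^Fin (k + 1)]→ₗ[ℝ] ℝ) (x : Fin (k + 2) → g) : ℝ :=
  ∑ j : Fin (k + 2), ∑ i : Fin (k + 1),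
    if i.castSucc < j then
      (-1) ^ ((i : ℕ) + (j : ℕ)) *
        α (Fin.cons ⁅x i.castSucc, x j⁆ (i.removeNth (j.removeNth x)))
    else 0

/-- A form is closed if its Chevalley-Eilenberg differential vanishes. -/
def IsClosedForm {k : ℕ} (α : g [⋀^Fin (k + 1)]→ₗ[ℝ] ℝ) : Prop :=
  ∀ x : Fin (k + 2) → g, ceDiff α x = 0

/-- The pair `(ω, ρ)` is a half-flat `SU(3)`-structure on the six-dimensional Lie algebra `g`,
where `J_ρ` is formed with the orientation of `g` given by the volume form `ν`. -/
structure IsHalfFlatSU3 (hg : Module.finrank ℝ g = 6) {ν : g [⋀^Fin 6]→ₗ[ℝ] ℝ} (hν : ν ≠ 0)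
    (ω : g [⋀^Fin 2]→ₗ[ℝ] ℝ) (ρ : g [⋀^Fin 3]→ₗ[ℝ] ℝ) : Prop where
  stable_two : IsStable ω
  stable_three : IsStable ρ
  lambda_neg : hitchinLambda hg hν ρ < 0
  compatible : wedge ω ρ = 0
  closed_sq : IsClosedForm (k := 3) (wedge (p := 2) (q := 2) ω ω)
  closed_three : IsClosedForm (k := 2) ρ
  /-- `g(x, y) = ω(J_ρ x, y)` is symmetric -/
  metric_symm : ∀ x y : g, ω ![hitchinJ hg hν ρ x, y] = ω ![hitchinJ hg hν ρ y, x]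
  /-- and positive definite. -/
  metric_pos : ∀ x : g, x ≠ 0 → 0 < ω ![hitchinJ hg hν ρ x, x]

variable (g) in
/-- `g` admits a half-flat `SU(3)`-structure, for some choice of orientation. -/
def AdmitsHalfFlatSU3 (hg : Module.finrank ℝ g = 6) : Prop :=
  ∃ (ν : g [⋀^Fin 6]→ₗ[ℝ] ℝ) (hν : ν ≠ 0) (ω : g [⋀^Fin 2]→ₗ[ℝ] ℝ) (ρ : g [⋀^Fin 3]→ₗ[ℝ] ℝ),
    IsHalfFlatSU3 hg hν ω ρ

end LieAlgebras

end HalfFlat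

/-! Let `N` be the nilradical, an abelian ideal of codimension one with `N = ker θ`, `θ e = 1`, and
let `A` be `ad e` on `N`. Closedness of `ρ` and `ω ∧ ω` says that the derivation induced by `A`
kills both forms restricted to `N`. Let `n` be the vector with `ω(n, ·) = θ`; it lies in `N` and
spans the kernel of `ω|N`. The map `y ↦ (y ⌟ ρ) ∧ ρ`, restricted to `N`, takes values in the line
`Λ⁵N^*`, hence is a functional `q`. Invariance of `ρ` gives `q ∘ A = -tr A · q`, and positivity of
the metric at `n` gives `q n ≠ 0`. Invariance of `ω²` gives `A n = a n` and makes `A` traceless on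
`N / ⟨n⟩`, so `tr A = a`. Evaluating `q ∘ A` at `n` gives `a = -tr A`, whence `a = 0`. Thus `n` is
central and `q` kills all brackets, so the line of `n` and `ker q` are complementary non-zero
ideals. The carriers are `contractWedge_of_isLieDeriv`, `kernel_and_range_of_isLieDeriv` and
`IsHalfFlatSU3.not_isIndecomposable`. -/

namespace HalfFlat

/-! ### Wedge products as permutation sums. -/

section Forms

variable {V W : Type*} [AddCommGroup V] [Module ℝ V] [AddCommGroup W] [Module ℝ W]

/-- The wedge product as a normalised sum over all permutations. -/
theorem factorial_mul_wedge {p q : ℕ} (a : V [⋀^Fin p]→ₗ[ℝ] ℝ) (b : V [⋀^Fin q]→ₗ[ℝ] ℝ)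
    (v : Fin (p + q) → V) :
    ((p.factorial * q.factorial : ℕ) : ℝ) * wedge a b v =
      ∑ σ : Equiv.Perm (Fin p ⊕ Fin q), ((Equiv.Perm.sign σ : ℤ) : ℝ) *
        (a (fun i => v (finSumFinEquiv (σ (Sum.inl i)))) *
          b (fun i => v (finSumFinEquiv (σ (Sum.inr i))))) := by
  -- Alternatising the plain product counts each shuffle `p! q!` times.
  have h := DFunLike.congr_fun (MultilinearMap.domCoprod_alternization_eq a b)
    (v ∘ finSumFinEquiv)
  have h2 := congrArg (LinearMap.mul' ℝ ℝ) h
  simp only [Fintype.card_fin, AlternatingMap.smul_apply, map_nsmul] at h2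
  rw [nsmul_eq_mul] at h2
  refine (Eq.trans ?_ h2.symm).trans ?_
  · rfl
  · rw [MultilinearMap.alternatization_apply, map_sum]
    refine Finset.sum_congr rfl fun σ _ => ?_
    rw [Units.smul_def, map_zsmul, zsmul_eq_mul, MultilinearMap.domDomCongr_apply,
      MultilinearMap.domCoprod_apply, LinearMap.mul'_apply]
    rfl

theorem wedge_compLinearMap {p q : ℕ} (a : V [⋀^Fin p]→ₗ[ℝ] ℝ) (b : V [⋀^Fin q]→ₗ[ℝ] ℝ)
    (f : W →ₗ[ℝ] V) :
    (wedge a b).compLinearMap f = wedge (a.compLinearMap f) (b.compLinearMap f) := by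
  ext v
  have hpos : ((p.factorial * q.factorial : ℕ) : ℝ) ≠ 0 :=
    Nat.cast_ne_zero.2 (Nat.mul_ne_zero p.factorial_ne_zero q.factorial_ne_zero)
  refine mul_left_cancel₀ hpos ?_
  rw [AlternatingMap.compLinearMap_apply, factorial_mul_wedge, factorial_mul_wedge]
  rfl

/-- `a'` is the image of `a` under the derivation of the algebra of forms induced by `A`. -/
def IsLieDeriv {k : ℕ} (A : V →ₗ[ℝ] V) (a a' : V [⋀^Fin k]→ₗ[ℝ] ℝ) : Prop :=
  ∀ v : Fin k → V, ∑ i, a (Function.update v i (A (v i))) = a' v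

/-- The Leibniz rule for the derivation induced by an endomorphism. -/
theorem IsLieDeriv.wedge {p q : ℕ} {A : V →ₗ[ℝ] V} {a a' : V [⋀^Fin p]→ₗ[ℝ] ℝ}
    {b b' : V [⋀^Fin q]→ₗ[ℝ] ℝ} (ha : IsLieDeriv A a a') (hb : IsLieDeriv A b b')
    (v : Fin (p + q) → V) :
    ∑ i, HalfFlat.wedge a b (Function.update v i (A (v i))) =
      HalfFlat.wedge a' b v + HalfFlat.wedge a b' v := by
  have hpos : ((p.factorial * q.factorial : ℕ) : ℝ) ≠ 0 :=
    Nat.cast_ne_zero.2 (Nat.mul_ne_zero p.factorial_ne_zero q.factorial_ne_zero)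
  refine mul_left_cancel₀ hpos ?_
  rw [Finset.mul_sum, mul_add]
  simp only [factorial_mul_wedge]
  rw [Finset.sum_comm, ← Finset.sum_add_distrib]
  refine Finset.sum_congr rfl fun σ _ => ?_
  rw [← Finset.mul_sum, ← mul_add]
  congr 1
  -- For fixed `σ`, each slot feeds exactly one of the two factors; indexing the slots through `σ`
  -- turns the claim into the product rule.
  rw [← ha, ← hb, ← (σ.trans finSumFinEquiv).sum_comp, Fintype.sum_sum_type, Finset.sum_mul,
    Finset.mul_sum]
  congr 1
  · refine Finset.sum_congr rfl fun i _ => ?_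
    congr 2
    · funext j
      by_cases h : j = i
      · subst h; simp
      · simp [Function.update_of_ne, h]
    · funext j
      simp [Function.update_of_ne]
  · refine Finset.sum_congr rfl fun i _ => ?_
    congr 2
    · funext j
      simp [Function.update_of_ne]
    · funext j
      by_cases h : j = i
      · subst h; simp
      · simp [Function.update_of_ne, h]

theorem two_form_swap (w : V [⋀^Fin 2]→ₗ[ℝ] ℝ) (x y : V) : w ![x, y] = - w ![y, x] := by
  have := w.map_swap ![y, x] (i := 0) (j := 1) (by decide)
  rw [← this]
  congr 1
  funext i; fin_cases i <;> rfl

/-- The sum over the permutations of four indices as an explicit alternating sum. -/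
theorem sum_perm_fin_four (H : Fin 4 → Fin 4 → Fin 4 → Fin 4 → ℝ) :
    ∑ σ : Equiv.Perm (Fin 4), ((Equiv.Perm.sign σ : ℤ) : ℝ) * H (σ 0) (σ 1) (σ 2) (σ 3) =
      (H 0 1 2 3 - H 0 1 3 2 - H 0 2 1 3 + H 0 2 3 1 + H 0 3 1 2 - H 0 3 2 1)
      - (H 1 0 2 3 - H 1 0 3 2 - H 1 2 0 3 + H 1 2 3 0 + H 1 3 0 2 - H 1 3 2 0)
      + (H 2 0 1 3 - H 2 0 3 1 - H 2 1 0 3 + H 2 1 3 0 + H 2 3 0 1 - H 2 3 1 0)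
      - (H 3 0 1 2 - H 3 0 2 1 - H 3 1 0 2 + H 3 1 2 0 + H 3 2 0 1 - H 3 2 1 0) := by
  have hsum : ∀ F : Equiv.Perm (Fin 4) → ℝ, ∑ σ, F σ =
      ∑ p : Fin 4, ∑ q : Fin 3, ∑ r : Fin 2,
        F (Equiv.Perm.decomposeFin.symm (p, Equiv.Perm.decomposeFin.symm
          (q, Equiv.Perm.decomposeFin.symm (r, 1)))) := by
    intro F
    rw [← Equiv.Perm.decomposeFin.symm.sum_comp, Fintype.sum_prod_type]
    refine Finset.sum_congr rfl fun p _ => ?_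
    rw [← Equiv.Perm.decomposeFin.symm.sum_comp, Fintype.sum_prod_type]
    refine Finset.sum_congr rfl fun q _ => ?_
    rw [← Equiv.Perm.decomposeFin.symm.sum_comp, Fintype.sum_prod_type]
    refine Finset.sum_congr rfl fun r _ => ?_
    rw [Fintype.sum_unique]
    rfl
  -- Each permutation is a product of three transpositions, possibly trivial, encoded by `(p, q,
  -- r)`; a zero entry is a trivial one and contributes sign `1`.
  let P (p : Fin 4) (q : Fin 3) (r : Fin 2) : Equiv.Perm (Fin 4) :=
    Equiv.Perm.decomposeFin.symm (p, Equiv.Perm.decomposeFin.symm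
          (q, Equiv.Perm.decomposeFin.symm (r, 1)))
  have hs : ∀ p q r, Equiv.Perm.sign (P p q r) = (if p = 0 then 1 else -1) *
      ((if q = 0 then 1 else -1) * (if r = 0 then 1 else -1)) := by
    intro p q r
    simp only [P, Equiv.Perm.decomposeFin.symm_sign, Equiv.Perm.sign_one, mul_one]
  rw [hsum]
  change ∑ p, ∑ q, ∑ r, ((Equiv.Perm.sign (P p q r) : ℤ) : ℝ) *
    H (P p q r 0) (P p q r 1) (P p q r 2) (P p q r 3) = _
  simp only [hs, Fin.sum_univ_four, Fin.sum_univ_three, Fin.sum_univ_two]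
  have ht : ∀ p q r i, P p q r i =
      (![![![![0, 1, 2, 3], ![0, 1, 3, 2]], ![![0, 2, 1, 3], ![0, 2, 3, 1]], ![![0, 3, 2, 1],
        ![0, 3, 1, 2]]], ![![![1, 0, 2, 3], ![1, 0, 3, 2]], ![![1, 2, 0, 3], ![1, 2, 3,
        0]], ![![1, 3, 2, 0], ![1, 3, 0, 2]]], ![![![2, 1, 0, 3], ![2, 1, 3, 0]], ![![2,
        0, 1, 3], ![2, 0, 3, 1]], ![![2, 3, 0, 1], ![2, 3, 1, 0]]], ![![![3, 1, 2, 0],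
        ![3, 1, 0, 2]], ![![3, 2, 1, 0], ![3, 2, 0, 1]], ![![3, 0, 2, 1], ![3, 0, 1, 2]]]]
        : Fin 4 → Fin 3 → Fin 2 → Fin 4 → Fin 4) p q r i := by
    decide
  simp only [ht, Matrix.cons_val, if_true, Fin.reduceEq, one_ne_zero, if_false, Units.val_neg,
    Units.val_one, mul_one, one_mul, neg_mul, mul_neg, neg_neg, Int.cast_neg, Int.cast_one]
  ring

/-- The square of a two-form, evaluated on four vectors. -/
theorem wedge_self_apply (w : V [⋀^Fin 2]→ₗ[ℝ] ℝ) (v : Fin 4 → V) :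
    wedge (p := 2) (q := 2) w w v =
      2 * (w ![v 0, v 1] * w ![v 2, v 3] - w ![v 0, v 2] * w ![v 1, v 3]
        + w ![v 0, v 3] * w ![v 1, v 2]) := by
  have h := factorial_mul_wedge w w v
  have e2 : ∀ f : Fin 2 → V, w f = w ![f 0, f 1] := fun f => by
    congr 1; funext i; fin_cases i <;> rfl
  rw [← (finSumFinEquiv (m := 2) (n := 2)).symm.permCongr.sum_comp] at h
  simp only [Equiv.permCongr_apply, Equiv.Perm.sign_permCongr, Equiv.symm_symm,
    Equiv.apply_symm_apply] at h
  have h' := (h.trans (Finset.sum_congr rfl fun σ _ =>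
    congrArg _ (congrArg₂ (· * ·) (e2 _) (e2 _)))).trans
    (sum_perm_fin_four fun i j k l => w ![v i, v j] * w ![v k, v l])
  simp only [two_form_swap w (v 1) (v 0), two_form_swap w (v 2) (v 0), two_form_swap w (v 3) (v 0),
    two_form_swap w (v 2) (v 1), two_form_swap w (v 3) (v 1), two_form_swap w (v 3) (v 2)] at h'
  -- The 24 terms form three groups of eight equal ones; division by `2! 2!` leaves the coefficient
  -- 2.
  norm_num [Nat.factorial] at h'
  linarith

end Forms
-- Linear algebra of invariant forms in dimension five.
section Derivations

variable {V : Type*} [AddCommGroup V] [Module ℝ V]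

/-- The derivation induced by `A` multiplies top-degree forms by the trace of `A`. -/
theorem sum_update_basis {k : ℕ} (b : Module.Basis (Fin k) ℝ V) (A : V →ₗ[ℝ] V)
    (μ : V [⋀^Fin k]→ₗ[ℝ] ℝ) :
    ∑ i, μ (Function.update b i (A (b i))) = LinearMap.trace ℝ V A * μ b := by
  rw [LinearMap.trace_eq_matrix_trace ℝ b, Matrix.trace, Finset.sum_mul]
  refine Finset.sum_congr rfl fun i _ => ?_
  conv_lhs => rw [← b.sum_repr (A (b i))]
  rw [AlternatingMap.map_update_sum, Finset.sum_eq_single i]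
  · rw [AlternatingMap.map_update_smul, Function.update_eq_self, Matrix.diag_apply,
      LinearMap.toMatrix_apply, smul_eq_mul]
  · intro j _ hj
    rw [AlternatingMap.map_update_smul, AlternatingMap.map_update_self _ _ hj.symm, smul_zero]
  · simp

theorem eq_zero_of_map_basis_eq_zero {k : ℕ} (b : Module.Basis (Fin k) ℝ V)
    (μ : V [⋀^Fin k]→ₗ[ℝ] ℝ) (h : μ b = 0) : μ = 0 :=
  (AlternatingMap.map_basis_eq_zero_iff b μ).1 h

theorem contractWedge_apply (ρ : V [⋀^Fin 3]→ₗ[ℝ] ℝ) (y : V) :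
    contractWedge ρ y = wedge (p := 2) (q := 3) (AlternatingMap.curryLeft (n := 2) ρ y) ρ := by
  simp only [contractWedge, LinearMap.coe_mk, AddHom.coe_mk]

/-- The functional `y ↦ ((y ⌟ ρ) ∧ ρ)(b)` for a fixed family of five vectors `b`. -/
noncomputable def contractWedgeEval (ρ : V [⋀^Fin 3]→ₗ[ℝ] ℝ) (b : Fin 5 → V) : V →ₗ[ℝ] ℝ where
  toFun y := contractWedge ρ y b
  map_add' x y := by rw [map_add, AlternatingMap.add_apply]
  map_smul' c x := by rw [map_smul, AlternatingMap.smul_apply, RingHom.id_apply]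

theorem contractWedgeEval_apply (ρ : V [⋀^Fin 3]→ₗ[ℝ] ℝ) (b : Fin 5 → V) (y : V) :
    contractWedgeEval ρ b y = contractWedge ρ y b := by
  simp only [contractWedgeEval, LinearMap.coe_mk, AddHom.coe_mk]

/-- If the derivation induced by `A` annihilates `ρ`, then `y ↦ (y ⌟ ρ) ∧ ρ` is equivariant. -/
theorem contractWedge_of_isLieDeriv (hV : Module.finrank ℝ V = 5) {A : V →ₗ[ℝ] V}
    {ρ : V [⋀^Fin 3]→ₗ[ℝ] ℝ} (hρ : IsLieDeriv A ρ 0) (y : V) :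
    contractWedge ρ (A y) = -LinearMap.trace ℝ V A • contractWedge ρ y := by
  have : FiniteDimensional ℝ V := Module.finite_of_finrank_eq_succ hV
  obtain ⟨b⟩ : Nonempty (Module.Basis (Fin 5) ℝ V) := ⟨Module.finBasisOfFinrankEq ℝ V hV⟩
  -- As `A` annihilates `ρ`, the term acting on the slot of `y` is minus the sum of the others.
  have hc : IsLieDeriv A (AlternatingMap.curryLeft (n := 2) ρ y)
      (AlternatingMap.curryLeft (n := 2) ρ (-A y)) := by
    intro v
    have h := hρ (Matrix.vecCons y v)
    rw [Fin.sum_univ_succ] at h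
    simp only [AlternatingMap.curryLeft_apply_apply, AlternatingMap.zero_apply] at h ⊢
    have h0 : Function.update (Matrix.vecCons y v) 0 (A (Matrix.vecCons y v 0)) =
        Matrix.vecCons (A y) v := by
      simp [Matrix.vecCons]
    have hs : ∀ i : Fin 2, Function.update (Matrix.vecCons y v) i.succ
        (A (Matrix.vecCons y v i.succ)) = Matrix.vecCons y (Function.update v i (A (v i))) := by
      intro i
      simp [Matrix.vecCons, Fin.cons_update]
    simp only [h0, hs] at h
    have hneg : ρ (Matrix.vecCons (-A y) v) = -ρ (Matrix.vecCons (A y) v) :=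
      DFunLike.congr_fun (map_neg (AlternatingMap.curryLeft (n := 2) ρ) (A y)) v
    rw [hneg]
    linarith
  have h := hc.wedge hρ b
  have h0 : wedge (p := 2) (q := 3) (AlternatingMap.curryLeft (n := 2) ρ y) 0 = 0 := by
    ext v
    have := factorial_mul_wedge (AlternatingMap.curryLeft (n := 2) ρ y) (0 : V [⋀^Fin 3]→ₗ[ℝ] ℝ) v
    simpa [Nat.factorial] using this
  have h1 : wedge (p := 2) (q := 3) (AlternatingMap.curryLeft (n := 2) ρ (-A y)) ρ =
      contractWedge ρ (-A y) := (contractWedge_apply ρ _).symm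
  -- The same derivative is computed twice: by the Leibniz rule, and as a trace in top degree.
  have h2 := sum_update_basis b A (contractWedge ρ y)
  rw [h0, h1, LinearMap.map_neg] at h
  have h3 : LinearMap.trace ℝ V A * contractWedge ρ y b = -contractWedge ρ (A y) b := by
    rw [AlternatingMap.neg_apply, AlternatingMap.zero_apply, add_zero] at h
    rw [← h2, ← h, contractWedge_apply]
  rw [← sub_eq_zero]
  refine eq_zero_of_map_basis_eq_zero b _ ?_
  simp only [AlternatingMap.sub_apply, AlternatingMap.smul_apply, smul_eq_mul]
  linarith

theorem two_form_add_left (w : V [⋀^Fin 2]→ₗ[ℝ] ℝ) (x y z : V) :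
    w ![x + y, z] = w ![x, z] + w ![y, z] :=
  DFunLike.congr_fun (map_add (AlternatingMap.curryLeft (n := 1) w) x y) ![z]

theorem two_form_smul_left (w : V [⋀^Fin 2]→ₗ[ℝ] ℝ) (c : ℝ) (x z : V) :
    w ![c • x, z] = c * w ![x, z] :=
  DFunLike.congr_fun (map_smul (AlternatingMap.curryLeft (n := 1) w) c x) ![z]

/-- A two-form as a bilinear map. -/
noncomputable def twoFormBilin (w : V [⋀^Fin 2]→ₗ[ℝ] ℝ) : V →ₗ[ℝ] V →ₗ[ℝ] ℝ :=
  LinearMap.mk₂ ℝ (fun x y => w ![x, y]) (two_form_add_left w) (two_form_smul_left w)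
    (fun x y z => by
      rw [two_form_swap, two_form_add_left, two_form_swap w x y, two_form_swap w x z, neg_add])
    (fun c x y => by
      rw [two_form_swap, two_form_smul_left, two_form_swap w x y, smul_eq_mul, mul_neg])

@[simp]
theorem twoFormBilin_apply (w : V [⋀^Fin 2]→ₗ[ℝ] ℝ) (x y : V) : twoFormBilin w x y = w ![x, y] :=
  rfl

/-- On a five-dimensional space, let `n` span the kernel of the two-form `w`, and let `q` be a
functional with `q n ≠ 0`. Then every pair `u, x` with `w(u, x) ≠ 0` extends to four vectors on
which the square of `w` does not vanish. -/
theorem exists_wedge_self_ne_zero (hV : Module.finrank ℝ V = 5) {w : V [⋀^Fin 2]→ₗ[ℝ] ℝ} {n : V}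
    (hker : ∀ z, (∀ x, w ![z, x] = 0) → ∃ t : ℝ, z = t • n) (q : V →ₗ[ℝ] ℝ) (hq : q n ≠ 0)
    {u x : V} (hux : w ![u, x] ≠ 0) :
    ∃ y z, wedge (p := 2) (q := 2) w w ![u, x, y, z] ≠ 0 := by
  have : FiniteDimensional ℝ V := Module.finite_of_finrank_eq_succ hV
  -- Three linear conditions in dimension five leave some `y ≠ 0`. Orthogonality to `u` and `x`
  -- reduces the square of `w` to `2 w(u,x) w(y,z)`; `q y = 0` keeps `y` off the line of `n`, so
  -- some `z` pairs with it.
  let f : V →ₗ[ℝ] Fin 3 → ℝ := LinearMap.pi ![twoFormBilin w u, twoFormBilin w x, q]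
  have hf : LinearMap.ker f ≠ ⊥ := LinearMap.ker_ne_bot_of_finrank_lt (by simp [hV])
  obtain ⟨y, hy, hy0⟩ := Submodule.exists_mem_ne_zero_of_ne_bot hf
  have hy := LinearMap.mem_ker.1 hy
  have hy1 : w ![u, y] = 0 := by simpa [f] using congrFun hy 0
  have hy2 : w ![x, y] = 0 := by simpa [f] using congrFun hy 1
  have hy3 : q y = 0 := by simpa [f] using congrFun hy 2
  have : ∃ z, w ![y, z] ≠ 0 := by
    by_contra! h
    obtain ⟨t, rfl⟩ := hker y h
    rw [map_smul, smul_eq_mul] at hy3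
    exact hy0 (by rw [(mul_eq_zero.1 hy3).resolve_right hq, zero_smul])
  obtain ⟨z, hz⟩ := this
  refine ⟨y, z, ?_⟩
  rw [wedge_self_apply]
  simp [hy1, hy2, hux, hz]

/-- The linear-algebraic core: an endomorphism `A` of a five-dimensional space whose induced
derivation annihilates the three-form `ρ` and the square of the two-form `w` annihilates the kernel
of `w`, and `(A y ⌟ ρ) ∧ ρ = 0` for all `y`. -/
theorem kernel_and_range_of_isLieDeriv (hV : Module.finrank ℝ V = 5) {A : V →ₗ[ℝ] V}
    {ρ : V [⋀^Fin 3]→ₗ[ℝ] ℝ} {w : V [⋀^Fin 2]→ₗ[ℝ] ℝ} {n : V}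
    (hρ : IsLieDeriv A ρ 0) (hw : IsLieDeriv A (wedge (p := 2) (q := 2) w w) 0)
    (hn : ∀ x, w ![n, x] = 0)
    (hker : ∀ z, (∀ x, w ![z, x] = 0) → ∃ t : ℝ, z = t • n)
    (hT : contractWedge ρ n ≠ 0) :
    A n = 0 ∧ ∀ y, contractWedge ρ (A y) = 0 := by
  have : FiniteDimensional ℝ V := Module.finite_of_finrank_eq_succ hV
  have hn' : ∀ x, w ![x, n] = 0 := fun x => by rw [two_form_swap, hn, neg_zero]
  have hA := contractWedge_of_isLieDeriv hV hρ
  obtain ⟨b⟩ : Nonempty (Module.Basis (Fin 5) ℝ V) := ⟨Module.finBasisOfFinrankEq ℝ V hV⟩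
  obtain ⟨q, hqdef⟩ : ∃ q, q = contractWedgeEval ρ b := ⟨_, rfl⟩
  have hq : q n ≠ 0 := by
    rw [hqdef, contractWedgeEval_apply]
    exact fun h => hT (eq_zero_of_map_basis_eq_zero b _ h)
  have hqA : ∀ y, q (A y) = -LinearMap.trace ℝ V A * q y := fun y => by
    rw [hqdef, contractWedgeEval_apply, contractWedgeEval_apply, hA, AlternatingMap.smul_apply,
      smul_eq_mul]
  -- `n` is an eigenvector of `A`
  obtain ⟨a, ha⟩ : ∃ a : ℝ, A n = a • n := by
    refine hker _ fun x => ?_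
    by_contra hx
    obtain ⟨y, z, hyz⟩ := exists_wedge_self_ne_zero hV hker q hq hx
    refine hyz ?_
    -- The terms that leave `n` in place vanish, so only the one with `A n` remains.
    have h := (Fin.sum_univ_four _).symm.trans (hw ![n, x, y, z])
    simp only [AlternatingMap.zero_apply] at h
    simp only [wedge_self_apply] at h ⊢
    simpa [hn, Function.update] using h
  have hatr : a = -LinearMap.trace ℝ V A := by
    have := hqA n
    rw [ha, map_smul, smul_eq_mul] at this
    exact mul_right_cancel₀ hq this
  -- a basis of the hyperplane `q = 0`
  have hfin : Module.finrank ℝ (LinearMap.ker q) = 4 := by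
    have h1 := q.finrank_range_add_finrank_ker
    have h2 : LinearMap.range q = ⊤ :=
      LinearMap.range_eq_top.2 fun r => ⟨(r / q n) • n, by simp [hq]⟩
    rw [h2, finrank_top, hV, Module.finrank_self] at h1
    omega
  let c := Module.finBasisOfFinrankEq ℝ (LinearMap.ker q) hfin
  let B : Module.Basis (Fin 5) ℝ V := Module.Basis.mkFinCons n c
    (fun r x hx h => by
      have h1 := congrArg q h
      rw [map_add, map_smul, LinearMap.mem_ker.1 hx, map_zero, add_zero, smul_eq_mul] at h1
      exact (mul_eq_zero.1 h1).resolve_right hq)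
    (fun z => ⟨-(q z / q n), by
      rw [LinearMap.mem_ker, map_add, map_smul, smul_eq_mul]
      field_simp
      ring⟩)
  have hB : (B : Fin 5 → V) = Fin.cons n (Subtype.val ∘ c) := Module.Basis.coe_mkFinCons _ _ _ _
  have hB0 : B 0 = n := by rw [hB]; rfl
  have hBs : ∀ i : Fin 4, B i.succ = c i := fun i => by rw [hB]; rfl
  -- the restriction of the square of `w` to the hyperplane does not vanish
  have hcne : wedge (p := 2) (q := 2) w w (fun i => (c i : V)) ≠ 0 := by
    intro h0
    have h1 : (wedge (p := 2) (q := 2) w w).compLinearMap (LinearMap.ker q).subtype = 0 :=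
      (AlternatingMap.map_basis_eq_zero_iff c _).1 h0
    have h2 : ∃ u x, w ![u, x] ≠ 0 := by
      by_contra! h
      have h3 : ∀ z : V, ∃ t : ℝ, z = t • n := fun z => hker z (h z)
      have h4 := finrank_le_one n fun z => (h3 z).imp fun _ => Eq.symm
      omega
    obtain ⟨u, x, hux⟩ := h2
    obtain ⟨y, z, hyz⟩ := exists_wedge_self_ne_zero hV hker q hq hux
    -- Any vector can be moved along `n` into the hyperplane without changing its pairings under
    -- `w`.
    have hp : ∀ u : V, ∃ t : ℝ, u + t • n ∈ LinearMap.ker q := fun u => ⟨-(q u / q n), by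
      rw [LinearMap.mem_ker, map_add, map_smul, smul_eq_mul]
      field_simp
      ring⟩
    have hadd : ∀ (u x : V) (s t : ℝ), w ![u + s • n, x + t • n] = w ![u, x] := by
      intro u x s t
      rw [two_form_add_left, two_form_smul_left, hn, mul_zero, add_zero, two_form_swap,
        two_form_add_left, two_form_smul_left, hn, mul_zero, add_zero, ← two_form_swap]
    obtain ⟨t1, ht1⟩ := hp u
    obtain ⟨t2, ht2⟩ := hp x
    obtain ⟨t3, ht3⟩ := hp y
    obtain ⟨t4, ht4⟩ := hp z
    have h5 := DFunLike.congr_fun h1 ![⟨_, ht1⟩, ⟨_, ht2⟩, ⟨_, ht3⟩, ⟨_, ht4⟩]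
    rw [AlternatingMap.compLinearMap_apply, wedge_self_apply] at h5
    rw [wedge_self_apply] at hyz
    apply hyz
    simpa [hadd] using h5
  have hA0 : ∀ (v : Fin 4 → V) (i : Fin 4) (t : ℝ) (u : V),
      wedge (p := 2) (q := 2) w w (Function.update v i (t • n + u)) =
        wedge (p := 2) (q := 2) w w (Function.update v i u) := by
    intro v i t u
    rw [AlternatingMap.map_update_add, AlternatingMap.map_update_smul]
    have : wedge (p := 2) (q := 2) w w (Function.update v i n) = 0 := by
      rw [wedge_self_apply]
      fin_cases i <;> simp [Function.update, hn, hn']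
    rw [this, smul_zero, zero_add]
  -- This is the trace of `A` on the quotient by `n`: there the square of `w` is a non-zero
  -- invariant form of top degree.
  have htr4 : ∑ i : Fin 4, B.repr (A (c i)) i.succ = 0 := by
    have h := hw (fun i => (c i : V))
    have h1 : ∀ i : Fin 4, wedge (p := 2) (q := 2) w w (Function.update (fun i => (c i : V)) i (A (c i))) =
        B.repr (A (c i)) i.succ * wedge (p := 2) (q := 2) w w (fun i => (c i : V)) := by
      intro i
      conv_lhs => rw [← B.sum_repr (A (c i)), Fin.sum_univ_succ, hB0, hA0]
      rw [AlternatingMap.map_update_sum, Finset.sum_eq_single i]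
      · rw [AlternatingMap.map_update_smul, hBs]
        rw [Function.update_eq_self i (fun i => (c i : V)), smul_eq_mul]
      · intro j _ hj
        rw [AlternatingMap.map_update_smul, hBs,
          AlternatingMap.map_update_self _ (fun i => (c i : V)) hj.symm, smul_zero]
      · simp
    simp only [h1, AlternatingMap.zero_apply, ← Finset.sum_mul] at h
    exact (mul_eq_zero.1 h).resolve_right hcne
  have htr : LinearMap.trace ℝ V A = a := by
    rw [LinearMap.trace_eq_matrix_trace ℝ B, Matrix.trace, Fin.sum_univ_succ]
    simp only [Matrix.diag_apply, LinearMap.toMatrix_apply, hBs, htr4, add_zero]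
    rw [hB0, ha, ← hB0]
    simp
  have ha0 : a = 0 := by linarith
  refine ⟨by rw [ha, ha0, zero_smul], fun y => ?_⟩
  rw [hA, ← hatr, ha0, zero_smul]

end Derivations
-- From closed forms to a splitting of the Lie algebra.
section LieAlgebras

variable {g : Type*} [LieRing g] [LieAlgebra ℝ g]

/-- The differential of a form evaluated on `e` and pairwise commuting vectors `v`. -/
theorem ceDiff_cons {k : ℕ} (α : g [⋀^Fin (k + 1)]→ₗ[ℝ] ℝ) (e : g) (v : Fin (k + 1) → g)
    (hv : ∀ i j, ⁅v i, v j⁆ = 0) :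
    ceDiff α (Fin.cons e v) = -∑ i, α (Function.update v i ⁅e, v i⁆) := by
  have hz : ∀ w : Fin k → g, α (Fin.cons 0 w) = 0 := fun w =>
    α.map_coord_zero 0 (by simp)
  unfold ceDiff
  rw [Fin.sum_univ_succ, ← Finset.sum_neg_distrib]
  simp only [Fin.not_lt_zero, if_false, Finset.sum_const_zero, zero_add]
  refine Finset.sum_congr rfl fun j _ => ?_
  rw [Fin.sum_univ_succ]
  have hrest : ∀ i : Fin k, (if i.succ.castSucc < j.succ then
      (-1) ^ ((i.succ : ℕ) + (j.succ : ℕ)) *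
        α (Fin.cons ⁅(Fin.cons e v : Fin (k + 2) → g) i.succ.castSucc,
          (Fin.cons e v : Fin (k + 2) → g) j.succ⁆
          (i.succ.removeNth (j.succ.removeNth (Fin.cons e v : Fin (k + 2) → g))))
      else (0 : ℝ)) = 0 := by
    intro i
    rw [← Fin.succ_castSucc, Fin.cons_succ, Fin.cons_succ, hv, hz, mul_zero, ite_self]
  rw [Finset.sum_eq_zero fun i _ => hrest i, add_zero]
  have hrem : (0 : Fin (k + 1)).removeNth (j.succ.removeNth (Fin.cons e v : Fin (k + 2) → g)) =
      j.removeNth v := by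
    funext i
    simp [Fin.removeNth]
  have hupd : Function.update v j ⁅e, v j⁆ = j.insertNth ⁅e, v j⁆ (j.removeNth v) := by
    simp
  -- Moving the bracket from the front to slot `j` costs `(-1)^j`, while the differential carries
  -- `(-1)^(j+1)` because `e` shifts the index; hence the overall minus sign.
  rw [hrem, hupd, AlternatingMap.map_insertNth, if_pos (by simp)]
  simp only [Fin.castSucc_zero, Fin.cons_zero, Fin.cons_succ, Fin.val_zero, zero_add, Fin.val_succ,
    pow_succ, Matrix.vecCons]
  ring

/-- The restriction of a closed form to an abelian ideal is annihilated by the derivation induced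
by the adjoint action. -/
theorem IsClosedForm.isLieDeriv {k : ℕ} {α : g [⋀^Fin (k + 1)]→ₗ[ℝ] ℝ} (hα : IsClosedForm α)
    (N : Submodule ℝ g) (hN : ∀ x ∈ N, ∀ y ∈ N, ⁅x, y⁆ = 0) (e : g) (A : N →ₗ[ℝ] N)
    (hA : ∀ x, (A x : g) = ⁅e, (x : g)⁆) :
    IsLieDeriv A (α.compLinearMap N.subtype) 0 := by
  intro v
  have h := hα (Fin.cons e fun i => (v i : g))
  rw [ceDiff_cons _ _ _ fun i j => hN _ (v i).2 _ (v j).2, neg_eq_zero] at h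
  rw [AlternatingMap.zero_apply, ← h]
  refine Finset.sum_congr rfl fun i _ => ?_
  rw [AlternatingMap.compLinearMap_apply]
  congr 1
  funext j
  by_cases hj : j = i
  · subst hj; simp [hA]
  · simp [Function.update_of_ne, hj]

/-- Nondegeneracy comes from positivity of the metric, since `ω(J x, x) = -ω(x, J x)`. -/
theorem IsHalfFlatSU3.eq_zero_of_left_eq_zero {hg : Module.finrank ℝ g = 6}
    {ν : g [⋀^Fin 6]→ₗ[ℝ] ℝ} {hν : ν ≠ 0} {w : g [⋀^Fin 2]→ₗ[ℝ] ℝ} {ρ : g [⋀^Fin 3]→ₗ[ℝ] ℝ}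
    (h : IsHalfFlatSU3 hg hν w ρ) {x : g} (hx : ∀ y, w ![x, y] = 0) : x = 0 := by
  by_contra hx0
  have := h.metric_pos x hx0
  rw [two_form_swap, hx, neg_zero] at this
  exact lt_irrefl _ this

/-- A Lie algebra of dimension six with an abelian ideal of dimension five which admits a half-flat
`SU(3)`-structure is decomposable. -/
theorem IsHalfFlatSU3.not_isIndecomposable {hg : Module.finrank ℝ g = 6}
    {ν : g [⋀^Fin 6]→ₗ[ℝ] ℝ} {hν : ν ≠ 0} {w : g [⋀^Fin 2]→ₗ[ℝ] ℝ} {ρ : g [⋀^Fin 3]→ₗ[ℝ] ℝ}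
    (h : IsHalfFlatSU3 hg hν w ρ) (N : Submodule ℝ g) (hN : ∀ x ∈ N, ∀ y ∈ N, ⁅x, y⁆ = 0)
    (hNlie : ∀ x : g, ∀ y ∈ N, ⁅x, y⁆ ∈ N)
    (hN5 : Module.finrank ℝ N = 5) : ¬ IsIndecomposable g := by
  have : FiniteDimensional ℝ g := Module.finite_of_finrank_eq_succ hg
  -- a functional with kernel `N` and a complement of `N`
  obtain ⟨θ, hθ0, hθN⟩ := Submodule.exists_le_ker_of_lt_top N
    (lt_top_iff_ne_top.2 fun htop => by
      rw [htop, finrank_top, hg] at hN5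
      omega)
  obtain ⟨e, he⟩ : ∃ e, θ e = 1 := by
    obtain ⟨e, he⟩ := DFunLike.ne_iff.1 hθ0
    exact ⟨(θ e)⁻¹ • e, by rw [map_smul, smul_eq_mul, inv_mul_cancel₀ (by simpa using he)]⟩
  have hNker : N = LinearMap.ker θ := by
    refine Submodule.eq_of_le_of_finrank_eq hθN ?_
    have h1 := θ.finrank_range_add_finrank_ker
    have h2 : LinearMap.range θ = ⊤ := LinearMap.range_eq_top.2 fun r => ⟨r • e, by simp [he]⟩
    rw [h2, finrank_top, hg, Module.finrank_self] at h1
    omega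
  have hmem : ∀ x, x ∈ N ↔ θ x = 0 := fun x => by
    rw [← LinearMap.mem_ker, ← hNker]
  have hdec : ∀ z, z - θ z • e ∈ N := fun z => by
    rw [hmem, map_sub, map_smul, he, smul_eq_mul, mul_one, sub_self]
  -- the vector dual to `θ`
  have hinj : Function.Injective (twoFormBilin w) := by
    rw [← LinearMap.ker_eq_bot, LinearMap.ker_eq_bot']
    exact fun x hx => h.eq_zero_of_left_eq_zero fun y => by
      rw [← twoFormBilin_apply, hx, LinearMap.zero_apply]
  have hsurj : Function.Surjective (twoFormBilin w) :=
    (LinearMap.injective_iff_surjective_of_finrank_eq_finrank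
      (Subspace.dual_finrank_eq (K := ℝ) (V := g)).symm).1 hinj
  obtain ⟨n, hn⟩ := hsurj θ
  have hn : ∀ x, w ![n, x] = θ x := fun x => by rw [← twoFormBilin_apply, hn]
  have hn0 : n ≠ 0 := by
    rintro rfl
    have h1 := hn e
    rw [← twoFormBilin_apply, map_zero, LinearMap.zero_apply, he] at h1
    exact zero_ne_one h1
  have hnN : n ∈ N := by
    have h1 := two_form_swap w n n
    rw [hmem, ← hn]
    linarith
  -- the adjoint action of `e` on `N`
  obtain ⟨A, hA⟩ : ∃ A : N →ₗ[ℝ] N, ∀ x, (A x : g) = ⁅e, (x : g)⁆ :=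
    ⟨(LieAlgebra.ad ℝ g e).restrict (p := N) (q := N) (hNlie e), fun x => rfl⟩
  have hρ := h.closed_three.isLieDeriv N hN e A hA
  have hw := h.closed_sq.isLieDeriv N hN e A hA
  rw [wedge_compLinearMap] at hw
  obtain ⟨b⟩ : Nonempty (Module.Basis (Fin 5) ℝ N) := ⟨Module.finBasisOfFinrankEq ℝ N hN5⟩
  have hcw : ∀ y : N, contractWedge (ρ.compLinearMap N.subtype) y =
      (contractWedge ρ (y : g)).compLinearMap N.subtype := by
    intro y
    rw [contractWedge_apply, contractWedge_apply, wedge_compLinearMap,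
      AlternatingMap.curryLeft_compLinearMap]
    rfl
  have hcwb : ∀ y : N, contractWedge (ρ.compLinearMap N.subtype) y b =
      contractWedge ρ (y : g) fun j => (b j : g) := by
    intro y
    rw [hcw, AlternatingMap.compLinearMap_apply]
    simp only [Submodule.subtype_apply]
  -- Only the five evaluation vectors lie in `N`; the functional itself is defined on all of `g`, so
  -- its kernel can serve as an ideal of `g`.
  obtain ⟨q, hq⟩ : ∃ q, q = contractWedgeEval ρ fun j => (b j : g) := ⟨_, rfl⟩
  have hqN : ∀ y : N, q y = contractWedge (ρ.compLinearMap N.subtype) y b := by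
    intro y
    rw [hq, contractWedgeEval_apply, hcwb]
  have hKν : ∀ y : g, ν (Matrix.vecCons (hitchinK hg hν ρ y) fun j => (b j : g)) = q y := by
    intro y
    rw [← AlternatingMap.curryLeft_apply_apply, contraction_hitchinK, ← contractWedge_apply, hq,
      contractWedgeEval_apply]
  -- Positivity at `n` reads `ω(J n, n) = -θ(J n) > 0`, so `K n` lies outside `N`.
  have hK : θ (hitchinK hg hν ρ n) ≠ 0 := by
    intro h0
    have h1 := h.metric_pos n hn0
    rw [hitchinJ, LinearMap.smul_apply, two_form_smul_left, two_form_swap, hn, h0] at h1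
    simp at h1
  have hT : contractWedge (ρ.compLinearMap N.subtype) ⟨n, hnN⟩ ≠ 0 := by
    -- Since `K n` completes `b` to a basis of `g`, on which `ν` takes the value `q n`, vanishing
    -- would force `ν = 0`.
    intro h0
    let B : Module.Basis (Fin 6) ℝ g := Module.Basis.mkFinCons (hitchinK hg hν ρ n) b
      (fun r x hx hr => by
        have h1 := congrArg θ hr
        rw [map_add, map_smul, (hmem x).1 hx, add_zero, map_zero, smul_eq_mul] at h1
        exact (mul_eq_zero.1 h1).resolve_right hK)
      (fun z => ⟨-(θ z / θ (hitchinK hg hν ρ n)), by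
        rw [hmem, map_add, map_smul, smul_eq_mul]
        field_simp
        ring⟩)
    have hB : (B : Fin 6 → g) = Fin.cons (hitchinK hg hν ρ n) (Subtype.val ∘ b) :=
      Module.Basis.coe_mkFinCons _ _ _ _
    refine hν (eq_zero_of_map_basis_eq_zero B ν ?_)
    rw [hB]
    refine (hKν n).trans ?_
    have h2 := hqN ⟨n, hnN⟩
    rw [h0, AlternatingMap.zero_apply] at h2
    exact h2
  have hwn : ∀ x y : N, w.compLinearMap N.subtype ![x, y] = w ![(x : g), (y : g)] := fun x y => by
    rw [AlternatingMap.compLinearMap_apply]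
    congr 1
    funext j
    fin_cases j <;> rfl
  obtain ⟨hAn, hAy⟩ := kernel_and_range_of_isLieDeriv hN5 hρ hw (n := ⟨n, hnN⟩)
    (fun x => by rw [hwn, hn, ← hmem]; exact x.2)
    (fun z hz => by
      -- Splitting `y` along `N` and `e` gives `ω(z, y) = θ(y) ω(z, e) = ω(z, e) ω(n, y)`, which
      -- dictates the coefficient.
      refine ⟨w ![(z : g), e], Subtype.ext (sub_eq_zero.1 (h.eq_zero_of_left_eq_zero fun y => ?_))⟩
      have h1 := hz ⟨_, hdec y⟩
      rw [hwn] at h1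
      simp only [← twoFormBilin_apply, map_sub, map_smul, smul_eq_mul, LinearMap.sub_apply,
        Submodule.coe_smul, LinearMap.smul_apply] at h1 ⊢
      rw [twoFormBilin_apply w n, hn]
      linarith) hT
  -- the hyperplane complementary to `n`
  have hqn : q n ≠ 0 := by
    intro h0
    refine hT (eq_zero_of_map_basis_eq_zero b _ ?_)
    rw [← hqN]
    exact h0
  have hqA : ∀ y : N, q (A y) = 0 := fun y => by
    rw [hqN, hAy, AlternatingMap.zero_apply]
  have hqlie : ∀ x y : g, q ⁅x, y⁆ = 0 := by
    intro x y
    -- As `N` is abelian, every bracket lies in the range of `A`, where `q` vanishes.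
    have h1 : ⁅x, y⁆ = θ x • (A ⟨_, hdec y⟩ : g) - θ y • (A ⟨_, hdec x⟩ : g) := by
      have h2 := hN _ (hdec x) _ (hdec y)
      simp only [sub_lie, lie_sub, smul_lie, lie_smul, lie_self, smul_zero, sub_zero] at h2
      simp only [hA, lie_sub, lie_smul, lie_self, smul_zero, sub_zero]
      rw [← lie_skew x e, smul_neg] at h2
      rw [← sub_eq_zero, ← h2]
      abel
    rw [h1, map_sub, map_smul, map_smul, hqA, hqA, smul_zero, smul_zero, sub_zero]
  have hnlie : ∀ x : g, ⁅x, n⁆ = 0 := by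
    intro x
    have h1 := hN _ (hdec x) _ hnN
    have h2 := congrArg Subtype.val hAn
    rw [hA] at h2
    have h2 : ⁅e, n⁆ = 0 := h2
    rw [sub_lie, smul_lie, h2, smul_zero, sub_zero] at h1
    exact h1
  let I : LieIdeal ℝ g :=
    { (Submodule.span ℝ {n}) with
      lie_mem := fun {x m} hm => by
        obtain ⟨t, rfl⟩ := Submodule.mem_span_singleton.1 hm
        change ⁅x, t • n⁆ ∈ Submodule.span ℝ {n}
        rw [lie_smul, hnlie, smul_zero]
        exact Submodule.zero_mem _ }
  let J : LieIdeal ℝ g :=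
    { (LinearMap.ker q) with
      lie_mem := fun {x m} _ => LinearMap.mem_ker.2 (hqlie x m) }
  have hI : ∀ x, x ∈ I ↔ ∃ t : ℝ, t • n = x := fun x => Submodule.mem_span_singleton
  have hJ : ∀ x, x ∈ J ↔ q x = 0 := fun x => LinearMap.mem_ker
  intro hind
  have hcompl : IsCompl I J := by
    refine ⟨disjoint_iff.2 ((LieSubmodule.eq_bot_iff _).2 fun x hx => ?_),
      codisjoint_iff.2 (eq_top_iff.2 fun x _ => ?_)⟩
    · obtain ⟨hx1, hx2⟩ := LieSubmodule.mem_inf _ _ _ |>.1 hx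
      obtain ⟨t, rfl⟩ := (hI x).1 hx1
      have h1 := (hJ _).1 hx2
      rw [map_smul, smul_eq_mul] at h1
      rw [(mul_eq_zero.1 h1).resolve_right hqn, zero_smul]
    · rw [LieSubmodule.mem_sup]
      refine ⟨(q x / q n) • n, (hI _).2 ⟨_, rfl⟩, x - (q x / q n) • n, (hJ _).2 ?_, by abel⟩
      rw [map_sub, map_smul, smul_eq_mul, div_mul_cancel₀ _ hqn, sub_self]
  rcases hind I J hcompl with h0 | h0
  · exact hn0 ((LieSubmodule.eq_bot_iff _).1 h0 n ((hI n).2 ⟨1, one_smul _ _⟩))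
  -- A trivial kernel would embed the six-dimensional `g` into `ℝ`.
  · have hker : LinearMap.ker q = ⊥ := (Submodule.eq_bot_iff _).2 fun x hx =>
      (LieSubmodule.eq_bot_iff _).1 h0 x ((hJ x).2 hx)
    have h1 := LinearMap.finrank_le_finrank_of_injective (LinearMap.ker_eq_bot.1 hker)
    rw [hg, Module.finrank_self] at h1
    omega

end LieAlgebras
end HalfFlat

theorem proposition2p2 {g : Type*} [LieRing g] [LieAlgebra ℝ g]
    (hg : Module.finrank ℝ g = 6)
    (hindec : HalfFlat.IsIndecomposable g)
    (hnil : Nonempty (HalfFlat.nilradical g ≃ₗ⁅ℝ⁆ HalfFlat.AbelianLie 5)) :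
    ¬ HalfFlat.AdmitsHalfFlatSU3 g hg := by
  rintro ⟨ν, hν, w, ρ, h⟩
  obtain ⟨φ⟩ := hnil
  refine h.not_isIndecomposable (HalfFlat.nilradical g : Submodule ℝ g)
    (fun x hx y hy => ?_) (fun x y hy => (HalfFlat.nilradical g).lie_mem hy) ?_ hindec
  · have h1 : ⁅(⟨x, hx⟩ : HalfFlat.nilradical g), (⟨y, hy⟩ : HalfFlat.nilradical g)⁆ = 0 := by
      apply φ.injective
      exact (LieHom.map_lie φ.toLieHom _ _).trans (map_zero φ.toLinearEquiv).symm
    exact congrArg Subtype.val h1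
  · exact φ.toLinearEquiv.finrank_eq.trans (Module.finrank_fin_fun ℝ)
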